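/- Let $K(x)=\tfrac12 e^{-|x|}$ for $x\in\mathbb R$. A function $u\in L^\infty_{\mathrm{loc}}(\mathbb R\times[0,\infty))$ is called a weak solution of the Fornberg--Whitham Cauchy problem $u_t+uu_x+K*u_x=0$, $u(\cdot,0)=u_0\in L^\infty_{\mathrm{loc}}(\mathbb R)$ (convolution in $x$ only), if for every test function $\phi\in\mathcal D(\mathbb R^2)$ the following integrals are well defined and $$\int_0^\infty\!\!\int_{-\infty}^\infty\Big(-u\,\partial_t\phi-\frac{u^2}{2}\,\partial_x\phi+\big(K'*u(\cdot,t)\big)(x)\,\phi\Big)\,dx\,dt=\int_{-\infty}^\infty u_0(x)\,\phi(x,0)\,dx .$$ Theorem. Let $A,B,c\in\mathbb R$ satisfy $c=1+\frac{A+B}{2}$ and $B+2<c<A$. Put $\alpha=\frac{(A-c)^2}{2}+A$ and consider the planar system $$U'=(U-c)V,\qquad V'=-V^2+\frac{U^2}{2}+(1-c)U+\frac{c^2}{2}-\alpha .$$ Then $(A,0)$ and $(B,0)$ are saddle points of this system (equilibria whose linearization has one negative and one positive eigenvalue), and there is a function $W:\mathbb R\to\mathbb R$ such that 1. $W$ is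 $C^2$ on $\mathbb R\setminus\{0\}$, and $W,W',W''$ have finite one-sided limits at $0$; 2. $W$ has a jump at $0$, i.e. $W(0-)\ne W(0+)$; 3. $\lim_{\xi\to-\infty}W(\xi)=A$ and $\lim_{\xi\to+\infty}W(\xi)=B$; 4. $u(x,t)=W(x-ct)$ is a weak solution of the Fornberg--Whitham Cauchy problem with $u_0=W$; 5. $W$ is patched from two orbits of the planar system: there are $b_1,b_2\in\mathbb R$ and solutions $P=(U_1,V_1):(-\infty,b_1]\to\mathbb R^2$ and $Q=(U_2,V_2):(-\infty,b_2]\to\mathbb R^2$ with $P(z)\to(A,0)$ and $Q(z)\to(B,0)$ as $z\to-\infty$, with $U_1>A$, $V_1>0$ on $(-\infty,b_1]$ and $B<U_2<c$, $V_2<0$ on $(-\infty,b_2]$, and with $U_1(b_1)+U_2(b_2)=2c$, $V_1(b_1)+V_2(b_2)=0$, such that $h_i(z)=\int_0^z(U_i(r+b_i)-c)\,dr$ defines bijections $h_1:(-\infty,0]\to(-\infty,0]$ and $h_2:(-\infty,0]\to[0,\infty)$, and $W(\xi)=U_1(h_1^{-1}(\xi)+b_1)$ for $\xi<0$, $W(\xi)=U_2(h_2^{-1}(\xi)+b_2)$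 for $\xi>0$. -/

import Mathlib

open MeasureTheory Filter Set Topology
open scoped ContDiff ENNReal

namespace FornbergWhitham

/-- The kernel `K(x) = (1/2) e^{-|x|}`, which satisfies `(1 - ∂²) K = δ`. -/
noncomputable def kernel (x : ℝ) : ℝ := (1 / 2) * Real.exp (-|x|)

/-- The spatial convolution `(K' ∗ f)(x) = ∫ K'(z) f(x - z) dz`. The kernel `K` is differentiable
off the null set `{0}`, and the value of `deriv kernel` at `0` plays no role in the integral. -/
noncomputable def convK' (f : ℝ → ℝ) (x : ℝ) : ℝ :=
  convolution (deriv kernel) f (ContinuousLinearMap.mul ℝ ℝ) volume x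

/-- `f` is measurable on `s` and essentially bounded on every compact subset of `s`,
i.e. `f ∈ L^∞_loc(s)`. -/
def LocEssBoundedOn {X : Type*} [TopologicalSpace X] [MeasureSpace X]
    (f : X → ℝ) (s : Set X) : Prop :=
  AEStronglyMeasurable f (volume.restrict s) ∧
    ∀ C ⊆ s, IsCompact C → MemLp f ∞ (volume.restrict C)

/-- Real test functions on `ℝ²`: smooth functions with compact support. -/
def IsTestFunction (φ : ℝ × ℝ → ℝ) : Prop :=
  ContDiff ℝ ∞ φ ∧ HasCompactSupport φ

/-- The integrand `-u ∂ₜφ - (u²/2) ∂ₓφ + (K' ∗ u(·,t)) φ` of the weak formulation, at `(x, t)`. -/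
noncomputable def weakIntegrand (u : ℝ → ℝ → ℝ) (φ : ℝ × ℝ → ℝ) (x t : ℝ) : ℝ :=
  -(u x t * deriv (fun s => φ (x, s)) t) - (u x t) ^ 2 / 2 * deriv (fun y => φ (y, t)) x
    + convK' (fun y => u y t) x * φ (x, t)

/-- `u` (a function of `x ∈ ℝ` and `t ≥ 0`) is a weak solution of
`u_t + u u_x + K ∗ u_x = 0`, `u(·,0) = u₀`. The existence of the convolution and the integrability
of the integrand say that the integrals in the weak formulation make sense. -/
structure IsWeakSolution (u : ℝ → ℝ → ℝ) (u₀ : ℝ → ℝ) : Prop where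
  locBounded : LocEssBoundedOn (fun p : ℝ × ℝ => u p.1 p.2) {p | 0 ≤ p.2}
  locBounded_init : LocEssBoundedOn u₀ univ
  convolution_exists : ∀ᵐ p : ℝ × ℝ, 0 < p.2 →
    ConvolutionExistsAt (deriv kernel) (fun y => u y p.2) p.1 (ContinuousLinearMap.mul ℝ ℝ) volume
  integrable : ∀ φ, IsTestFunction φ →
    IntegrableOn (fun p : ℝ × ℝ => weakIntegrand u φ p.1 p.2) {p | 0 < p.2}
  weak_eq : ∀ φ, IsTestFunction φ →
    ∫ t in Ioi (0 : ℝ), ∫ x : ℝ, weakIntegrand u φ x t = ∫ x : ℝ, u₀ x * φ (x, 0)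

/-- `f` has a (finite) left-hand and a (finite) right-hand limit at `0`. -/
def HasOneSidedLimits (f : ℝ → ℝ) : Prop :=
  (∃ l, Tendsto f (𝓝[<] 0) (𝓝 l)) ∧ ∃ r, Tendsto f (𝓝[>] 0) (𝓝 r)

/-- `W` is piecewise `C²`: it is `C²` off `0`, and `W`, `W'`, `W''` have one-sided limits
at `0`. -/
structure IsPiecewiseC2 (W : ℝ → ℝ) : Prop where
  contDiffOn : ContDiffOn ℝ 2 W {0}ᶜ
  limits : HasOneSidedLimits W
  limits_deriv : HasOneSidedLimits (deriv W)
  limits_deriv2 : HasOneSidedLimits (deriv (deriv W))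

/-- `W` has a genuine jump at `0`: the one-sided limits exist and `W(0-) ≠ W(0+)`. -/
def HasJump (W : ℝ → ℝ) : Prop :=
  ∃ l r, Tendsto W (𝓝[<] 0) (𝓝 l) ∧ Tendsto W (𝓝[>] 0) (𝓝 r) ∧ l ≠ r

/-- The planar vector field
`F(U, V) = ((U - c) V, -V² + U²/2 + (1 - c) U + c²/2 - α)`. -/
noncomputable def field (c α : ℝ) (p : ℝ × ℝ) : ℝ × ℝ :=
  ((p.1 - c) * p.2, -p.2 ^ 2 + p.1 ^ 2 / 2 + (1 - c) * p.1 + c ^ 2 / 2 - α)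

/-- `p` is a saddle point of the planar vector field `F`: an equilibrium at which the linearization
has one negative and one positive real eigenvalue. -/
def IsSaddle (F : ℝ × ℝ → ℝ × ℝ) (p : ℝ × ℝ) : Prop :=
  F p = 0 ∧ ∃ L : ℝ × ℝ →L[ℝ] ℝ × ℝ, HasFDerivAt F L p ∧
    (∃ μ < 0, Module.End.HasEigenvalue (L : ℝ × ℝ →ₗ[ℝ] ℝ × ℝ) μ) ∧
    ∃ ν > 0, Module.End.HasEigenvalue (L : ℝ × ℝ →ₗ[ℝ] ℝ × ℝ) ν

/-- `P : ]-∞, b] → ℝ²` solves `P' = F(P)` and tends to the point `p` as `z → -∞`. -/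
def IsOrbitFrom (F : ℝ × ℝ → ℝ × ℝ) (p : ℝ × ℝ) (P : ℝ → ℝ × ℝ) (b : ℝ) : Prop :=
  (∀ z ≤ b, HasDerivWithinAt P (F (P z)) (Iic b) z) ∧ Tendsto P atBot (𝓝 p)

/-- The change of coordinate `h(z) = ∫₀ᶻ (U(r + b) - c) dr` belonging to the shifted orbit
`z ↦ P(z + b)`, where `U` is the first component of `P`. -/
noncomputable def coord (c : ℝ) (P : ℝ → ℝ × ℝ) (b z : ℝ) : ℝ :=
  ∫ r in (0 : ℝ)..z, ((P (r + b)).1 - c)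

/-- `W` is patched at `0` from an orbit `P = (U₁, V₁)` leaving `(A, 0)` up and to the right and an
orbit `Q = (U₂, V₂)` leaving `(B, 0)` down and to the right, whose end points satisfy
`U₁(b₁) + U₂(b₂) = 2c` and `V₁(b₁) + V₂(b₂) = 0`: with the changes of coordinate
`h₁ : ]-∞, 0] → ]-∞, 0]` and `h₂ : ]-∞, 0] → [0, ∞[` one has
`W(ξ) = U₁(h₁⁻¹(ξ) + b₁)` for `ξ < 0` and `W(ξ) = U₂(h₂⁻¹(ξ) + b₂)` for `ξ > 0`. -/
structure IsPatched (A B c α : ℝ) (W : ℝ → ℝ) (P Q : ℝ → ℝ × ℝ) (b₁ b₂ : ℝ) : Prop where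
  orbit_left : IsOrbitFrom (field c α) (A, 0) P b₁
  region_left : ∀ z ≤ b₁, A < (P z).1 ∧ 0 < (P z).2
  orbit_right : IsOrbitFrom (field c α) (B, 0) Q b₂
  region_right : ∀ z ≤ b₂, B < (Q z).1 ∧ (Q z).1 < c ∧ (Q z).2 < 0
  match_fst : (P b₁).1 + (Q b₂).1 = 2 * c
  match_snd : (P b₁).2 + (Q b₂).2 = 0
  bijOn_left : BijOn (coord c P b₁) (Iic 0) (Iic 0)
  bijOn_right : BijOn (coord c Q b₂) (Iic 0) (Ici 0)
  eq_left : ∀ z < 0, W (coord c P b₁ z) = (P (z + b₁)).1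
  eq_right : ∀ z < 0, W (coord c Q b₂ z) = (Q (z + b₂)).1

end FornbergWhitham

/-!
The wave is explicit up to one change of coordinate. Write `a = A - c > 0` and `b = c - B = a + 2`.
In the planar system put `U = c + κ v`, with `(ρ, κ) = (a, 1)` near `(A, 0)` and
`(ρ, κ) = (b, -1)` near `(B, 0)`. In both cases the system becomes
`v' = v V`, `V' = -V² + (v - ρ)(v + ρ + 2κ)/2`, with the saddle at `v = ρ`. It has a first integral, and
on the unstable branch the reciprocal coordinate `X = κ / (v - ρ)` solves a linear equation with
constant coefficients (`exists_reciprocal_branch`). The branch is therefore given by `cosh` and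
`sinh`, and its existence for all negative times, its signs and its limit can be read off
(`exists_isHalfOrbit`). When both branches are stopped at `X = 1`, where `v = ρ + κ`, they end at the
same `v = a + 1 = b - 1` and with opposite values of `V`, which is the matching condition
`U₁ + U₂ = 2c`, `V₁ + V₂ = 0`. Reparametrising by `η = ∫₀ᶻ v` turns `V` into `dv/dη`, and `W` is
`c + v` on the left and the reflection of `c - v` on the right.

For the weak formulation let `E = (W - c)² / 2` and `D = (W - c) W'`. By the matching condition both
extend continuously across the jump, and off the origin `E' = D` and `D' = E + W + K` for a constant
`K`. So `e^{s-x} W` and `e^{x-s} W` have explicit antiderivatives, and `K' ∗ W = -D`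
(`convK'_eq_neg`). In the moving coordinate `y = x - c t` the integrand is then
`-W ∂ₜ[φ(y + c t, t)]` plus an exact `y`-derivative of a continuous function, which integrates to
zero; Fubini's theorem and an integration in `t` give the initial term (`isWeakSolution_of_profile`).
-/

namespace FornbergWhitham

/-! ### The unstable branches of the saddles -/

/-- In the reciprocal coordinate `X = κ / (v - ρ)` the unstable branch solves the linear equation
`X'' = ρ (ρ + κ) X + (κ ρ + 2/3) / 2`, whose solutions are combinations of `cosh`, `sinh` and a
constant. The third clause is the first integral on the level of the unstable branch; at
`X 0 = 1` it gives `X' 0 ^ 2 = (ρ + κ) ^ 2 - 1 / 12`, because `κ ^ 2 = 1`. -/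
lemma exists_reciprocal_branch {ρ κ : ℝ} (hκ : κ ^ 2 = 1) (hρ : 0 < ρ) (hm : 1 < ρ + κ) :
    ∃ X X' : ℝ → ℝ,
      (∀ z, HasDerivAt X (X' z) z) ∧
      (∀ z, HasDerivAt X' (ρ * (ρ + κ) * X z + (κ * ρ + 2 / 3) / 2) z) ∧
      (∀ z, X' z ^ 2 = ρ * (ρ + κ) * X z ^ 2 + (κ * ρ + 2 / 3) * X z + 1 / 4) ∧
      (∀ z ≤ 0, 1 ≤ X z ∧ X' z < 0) ∧ Tendsto X atBot atTop ∧
      X 0 = 1 ∧ X' 0 = -√((ρ + κ) ^ 2 - 1 / 12) := by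
  have hcase : κ = 1 ∨ κ = -1 := by simpa using hκ
  have hρm : 0 < ρ * (ρ + κ) := by positivity
  obtain ⟨k, hk, hk2⟩ : ∃ k : ℝ, 0 < k ∧ k ^ 2 = ρ * (ρ + κ) :=
    ⟨√(ρ * (ρ + κ)), by positivity, Real.sq_sqrt hρm.le⟩
  have hS0 : 0 < (ρ + κ) ^ 2 - 1 / 12 := by nlinarith
  set S := √((ρ + κ) ^ 2 - 1 / 12) with hS
  have hSpos : 0 < S := Real.sqrt_pos.2 hS0
  have hS2 : S ^ 2 = (ρ + κ) ^ 2 - 1 / 12 := Real.sq_sqrt hS0.le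
  -- `-d` is the equilibrium of the linear equation.
  obtain ⟨d, hd⟩ : ∃ d : ℝ, 2 * k ^ 2 * d = κ * ρ + 2 / 3 :=
    ⟨(κ * ρ + 2 / 3) / (2 * k ^ 2), by field_simp⟩
  have hd1 : 0 < 1 + d := by
    have : 0 < 2 * k ^ 2 * (1 + d) := by
      rw [mul_add, hd, hk2]
      rcases hcase with rfl | rfl <;> nlinarith
    exact pos_of_mul_pos_right this (by positivity)
  have hlin (z : ℝ) : HasDerivAt (fun z => k * z) k z := by
    simpa using (hasDerivAt_id z).const_mul k
  refine ⟨fun z => (1 + d) * Real.cosh (k * z) - S / k * Real.sinh (k * z) - d,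
    fun z => k * (1 + d) * Real.sinh (k * z) - S * Real.cosh (k * z),
    fun z => ?_, fun z => ?_, fun z => ?_, ?_⟩
  · have h := (((hlin z).cosh.const_mul (1 + d)).sub ((hlin z).sinh.const_mul (S / k))).sub_const d
    refine h.congr_deriv ?_
    field_simp
  · have h := ((hlin z).sinh.const_mul (k * (1 + d))).sub ((hlin z).cosh.const_mul S)
    refine h.congr_deriv ?_
    rw [← hd, ← hk2]
    field_simp
    ring
  · have hcs := Real.cosh_sq (k * z)
    have hSk : S ^ 2 = k ^ 2 * (1 + 2 * d) + 1 / 4 := by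
      rw [hS2]; linear_combination hκ - hk2 - hd
    rw [← hd, ← hk2]
    field_simp
    linear_combination 4 * (S ^ 2 - k ^ 2 * (1 + d) ^ 2) * hcs + 4 * hSk
  have hge (z : ℝ) (hz : z ≤ 0) :
      1 - S * z ≤ (1 + d) * Real.cosh (k * z) - S / k * Real.sinh (k * z) - d := by
    have h1 := Real.one_le_cosh (k * z)
    have h2 : Real.sinh (k * z) ≤ k * z := Real.sinh_le_self_iff.2 (by nlinarith)
    have h3 : S / k * Real.sinh (k * z) ≤ S / k * (k * z) :=
      mul_le_mul_of_nonneg_left h2 (by positivity)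
    have h4 : S / k * (k * z) = S * z := by field_simp
    nlinarith
  refine ⟨fun z hz => ⟨?_, ?_⟩, ?_, by simp, by simp⟩
  · nlinarith [hge z hz]
  · have h1 := Real.cosh_pos (k * z)
    have h2 : Real.sinh (k * z) ≤ 0 := Real.sinh_nonpos_iff.2 (by nlinarith)
    have : k * (1 + d) * Real.sinh (k * z) ≤ 0 :=
      mul_nonpos_of_nonneg_of_nonpos (by positivity) h2
    nlinarith
  · refine tendsto_atTop_mono' atBot ?_ (f₁ := fun z => 1 - S * z) ?_
    · filter_upwards [eventually_le_atBot 0] with z hz using hge z hz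
    · simp only [sub_eq_add_neg]
      refine tendsto_atTop_add_const_left _ _ (tendsto_neg_atBot_atTop.comp ?_)
      exact tendsto_id.const_mul_atBot hSpos

/-- The unstable branch of a saddle, up to time `0`, in coordinates that treat both saddles alike:
with `U = c + κ v`, the pair `(ρ, κ) = (A - c, 1)` describes the orbit leaving `(A, 0)` and
`(ρ, κ) = (c - B, -1)` the one leaving `(B, 0)`. Time is normalised so that `v 0 = ρ + κ`; this
value is the same for both saddles, and so is `κ V 0`. -/
structure IsHalfOrbit (ρ κ : ℝ) (v V : ℝ → ℝ) : Prop where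
  hasDerivAt_fst : ∀ z ≤ 0, HasDerivAt v (v z * V z) z
  hasDerivAt_snd : ∀ z ≤ 0, HasDerivAt V (-V z ^ 2 + (v z - ρ) * (v z + ρ + 2 * κ) / 2) z
  pos_fst : ∀ z ≤ 0, 0 < κ * (v z - ρ)
  le_fst : ∀ z ≤ 0, κ * (v z - ρ) ≤ 1
  pos_snd : ∀ z ≤ 0, 0 < κ * V z
  tendsto_fst : Tendsto v atBot (𝓝 ρ)
  tendsto_snd : Tendsto V atBot (𝓝 0)
  zero_fst : v 0 = ρ + κ
  zero_snd : V 0 = κ * (√((ρ + κ) ^ 2 - 1 / 12) / (ρ + κ))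

lemma exists_isHalfOrbit {ρ κ : ℝ} (hκ : κ ^ 2 = 1) (hρ : 0 < ρ) (hm : 1 < ρ + κ) :
    ∃ v V : ℝ → ℝ, IsHalfOrbit ρ κ v V := by
  have hcase : κ = 1 ∨ κ = -1 := by simpa using hκ
  obtain ⟨X, X', dX, dX', first, hX1, hXtop, hX0, hX'0⟩ := exists_reciprocal_branch hκ hρ hm
  obtain ⟨v, hv⟩ : ∃ v : ℝ → ℝ, v = fun z => ρ + κ / X z := ⟨_, rfl⟩
  obtain ⟨V, hV⟩ : ∃ V : ℝ → ℝ, V = fun z => -κ * X' z / X z ^ 2 / v z := ⟨_, rfl⟩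
  have hκv (z : ℝ) : κ * (v z - ρ) = 1 / X z := by
    simp only [hv]
    linear_combination (1 / X z) * hκ
  have hκvle (z : ℝ) (hz : z ≤ 0) : κ * (v z - ρ) ≤ 1 := by
    rw [hκv, div_le_one (by linarith [(hX1 z hz).1])]; exact (hX1 z hz).1
  have hκvpos (z : ℝ) (hz : z ≤ 0) : 0 < κ * (v z - ρ) := by
    rw [hκv]; have := (hX1 z hz).1; positivity
  have hvpos (z : ℝ) (hz : z ≤ 0) : 0 < v z := by
    have h1 := hκvle z hz
    have h2 := hκvpos z hz
    rcases hcase with rfl | rfl <;> linarith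
  have hvV (z : ℝ) (hz : z ≤ 0) : v z * V z = -κ * X' z / X z ^ 2 := by
    have := (hvpos z hz).ne'
    simp only [hV]; field_simp
  have dv (z : ℝ) (hz : z ≤ 0) : HasDerivAt v (v z * V z) z := by
    have hne : X z ≠ 0 := by linarith [(hX1 z hz).1]
    have h := (((dX z).inv hne).const_mul κ).const_add ρ
    rw [hvV z hz, hv]
    refine h.congr_deriv ?_
    ring
  have dV (z : ℝ) (hz : z ≤ 0) :
      HasDerivAt V (-V z ^ 2 + (v z - ρ) * (v z + ρ + 2 * κ) / 2) z := by
    have hne : X z ≠ 0 := by linarith [(hX1 z hz).1]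
    have hvne := (hvpos z hz).ne'
    have e : (-κ * (ρ * (ρ + κ) * X z + (κ * ρ + 2 / 3) / 2) * X z ^ 2
        - -κ * X' z * (2 * X z * X' z)) / (X z ^ 2) ^ 2
        = v z * ((v z - ρ) * (v z + ρ + 2 * κ) / 2) := by
      have h1 := first z
      have h2 : v z = ρ + κ / X z := by rw [hv]
      rw [h2]
      field_simp
      rcases hcase with rfl | rfl <;> grind
    have h1 : HasDerivAt (fun z => -κ * X' z / X z ^ 2)
        (v z * ((v z - ρ) * (v z + ρ + 2 * κ) / 2)) z := by
      refine (((dX' z).const_mul (-κ)).div ((dX z).pow 2) (pow_ne_zero 2 hne)).congr_deriv ?_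
      rw [← e]
      simp
    have h2 := h1.div (dv z hz) hvne
    have h3 : V = (fun z => -κ * X' z / X z ^ 2) / v := hV
    rw [← h3, ← hvV z hz] at h2
    refine h2.congr_deriv ?_
    field_simp
    ring
  have hvlim : Tendsto v atBot (𝓝 ρ) := by
    simpa [hv] using (hXtop.const_div_atTop κ).const_add ρ
  have hVlim : Tendsto V atBot (𝓝 0) := by
    have hnum : Tendsto (fun z => -κ * X' z / X z ^ 2) atBot (𝓝 0) := by
      -- The first integral bounds `|X'|` by a multiple of `X`.
      set M := √(ρ * (ρ + κ) + |κ * ρ + 2 / 3| + 1 / 4)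
      refine squeeze_zero_norm' (a := fun z => M / X z) ?_ (hXtop.const_div_atTop M)
      filter_upwards [eventually_le_atBot 0] with z hz
      have h1 := (hX1 z hz).1
      have hκ1 : |κ| = 1 := by rcases hcase with rfl | rfl <;> simp
      have hb : |X' z| ≤ M * X z := by
        rw [← Real.sqrt_sq_eq_abs, ← Real.sqrt_sq (by linarith : 0 ≤ X z),
          ← Real.sqrt_mul (by positivity), first]
        apply Real.sqrt_le_sqrt
        have := mul_le_mul_of_nonneg_right (le_abs_self (κ * ρ + 2 / 3)) (by linarith : 0 ≤ X z)
        nlinarith [mul_nonneg (abs_nonneg (κ * ρ + 2 / 3)) (by nlinarith : 0 ≤ X z ^ 2 - X z)]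
      rw [Real.norm_eq_abs, abs_div, abs_mul, abs_neg, hκ1, one_mul, abs_of_nonneg (sq_nonneg (X z)),
        div_le_div_iff₀ (by positivity) (by positivity)]
      nlinarith
    have := hnum.div hvlim hρ.ne'
    rw [zero_div] at this
    rw [hV]
    exact this
  refine ⟨v, V, dv, dV, hκvpos, hκvle, fun z hz => ?_, hvlim, hVlim, ?_, ?_⟩
  · have h1 := hvpos z hz
    have h2 : κ * V z = -X' z / X z ^ 2 / v z := by
      simp only [hV]; linear_combination (-X' z / X z ^ 2 / v z) * hκ
    have := (hX1 z hz).1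
    have := neg_pos.2 (hX1 z hz).2
    rw [h2]; positivity
  · simp [hv, hX0]
  · simp [hV, hv, hX0, hX'0]; ring

/-! ### The change of coordinate -/

/-- The inverse `T` of `z ↦ ∫₀ᶻ v` on `(-∞, 0]`. It is continuous on all of `ℝ`, which spares the
one-sided notions of continuity at `0` later on. -/
lemma exists_inverse_primitive {v : ℝ → ℝ} (hv : ContinuousOn v (Iic 0)) {δ : ℝ} (hδ : 0 < δ)
    (hδv : ∀ z ≤ 0, δ ≤ v z) :
    ∃ T : ℝ → ℝ, Continuous T ∧ T 0 = 0 ∧ (∀ η ≤ 0, T η ≤ 0) ∧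
      (∀ η < 0, HasDerivAt T (v (T η))⁻¹ η) ∧ Tendsto T atBot atBot ∧
      (∀ z ≤ 0, T (∫ r in (0 : ℝ)..z, v r) = z) ∧ (∀ η ≤ 0, ∫ r in (0 : ℝ)..T η, v r = η) := by
  -- Extending `v` by the constant `v 0` makes its primitive a homeomorphism of the whole line.
  set g : ℝ → ℝ := fun z => v (min z 0) with hg
  have gcont : Continuous g := hv.comp_continuous (by fun_prop) (fun z => min_le_right z 0)
  have gδ (z : ℝ) : δ ≤ g z := hδv _ (min_le_right z 0)
  set H : ℝ → ℝ := fun z => ∫ r in (0 : ℝ)..z, g r with hH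
  have hHd (z : ℝ) : HasDerivAt H (g z) z :=
    intervalIntegral.integral_hasDerivAt_right (gcont.intervalIntegrable _ _)
      gcont.stronglyMeasurable.stronglyMeasurableAtFilter gcont.continuousAt
  have hHcont : Continuous H := continuous_iff_continuousAt.2 fun z => (hHd z).continuousAt
  have hHmono : StrictMono H := strictMono_of_deriv_pos fun z => by
    rw [(hHd z).deriv]; linarith [gδ z]
  have hH0 : H 0 = 0 := by simp [hH]
  have hHlin : Monotone fun z => H z - δ * z := by
    refine monotone_of_deriv_nonneg (fun z => ?_) (fun z => ?_)
    · exact ((hHd z).sub ((hasDerivAt_id z).const_mul δ)).differentiableAt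
    · have := ((hHd z).sub ((hasDerivAt_id z).const_mul δ)).deriv
      change 0 ≤ deriv (H - fun z => δ * id z) z
      rw [this]; linarith [gδ z]
  have htop : Tendsto H atTop atTop := by
    refine tendsto_atTop_mono' atTop ?_ (tendsto_id.const_mul_atTop hδ)
    filter_upwards [eventually_ge_atTop 0] with z hz
    have := hHlin hz
    simp only [hH0] at this
    simp only [id]; linarith
  have hbot : Tendsto H atBot atBot := by
    refine tendsto_atBot_mono' atBot ?_ (tendsto_id.const_mul_atBot hδ)
    filter_upwards [eventually_le_atBot 0] with z hz
    have := hHlin hz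
    simp only [hH0] at this
    simp only [id]; linarith
  set e : ℝ ≃o ℝ := hHmono.orderIsoOfSurjective H (hHcont.surjective htop hbot) with he
  have heH (z : ℝ) : e z = H z := rfl
  have hsymm (η : ℝ) : H (e.symm η) = η := e.apply_symm_apply η
  have hHv (z : ℝ) (hz : z ≤ 0) : ∫ r in (0 : ℝ)..z, v r = H z := by
    refine intervalIntegral.integral_congr fun r hr => ?_
    rw [uIcc_of_ge hz] at hr
    simp only [hg, min_eq_left hr.2]
  have hT0 : e.symm 0 = 0 := by rw [e.symm_apply_eq, heH, hH0]
  have hTle (η : ℝ) (hη : η ≤ 0) : e.symm η ≤ 0 := hT0 ▸ e.symm.monotone hη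
  refine ⟨e.symm, e.symm.continuous, hT0, hTle, fun η hη => ?_, e.symm.tendsto_atBot,
    fun z hz => ?_, fun η hη => ?_⟩
  · have h := HasDerivAt.of_local_left_inverse (f := H) (g := e.symm) (a := η)
      e.symm.continuous.continuousAt (hHd _) (by linarith [gδ (e.symm η)])
      (Eventually.of_forall hsymm)
    simpa [hg, min_eq_left (hTle η hη.le)] using h
  · rw [hHv z hz, ← heH, e.symm_apply_apply]
  · rw [hHv _ (hTle η hη), hsymm]

/-- A half orbit `(v, V)` reparametrised by `η = ∫₀ᶻ v`: the functions `Y` and `Z` of `η ≤ 0` are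
`v` and `V` read in the coordinate `η`, so that `Y' = Z`. -/
structure IsHalfProfile (ρ κ : ℝ) (v Y Z : ℝ → ℝ) : Prop where
  continuousOn_fst : ContinuousOn Y (Iic 0)
  continuousOn_snd : ContinuousOn Z (Iic 0)
  hasDerivAt_fst : ∀ η < 0, HasDerivAt Y (Z η) η
  hasDerivAt_snd : ∀ η < 0,
    HasDerivAt Z ((-Z η ^ 2 + (Y η - ρ) * (Y η + ρ + 2 * κ) / 2) / Y η) η
  pos_fst : ∀ η ≤ 0, 0 < κ * (Y η - ρ)
  le_fst : ∀ η ≤ 0, κ * (Y η - ρ) ≤ 1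
  tendsto_fst : Tendsto Y atBot (𝓝 ρ)
  tendsto_snd : Tendsto Z atBot (𝓝 0)
  zero_fst : Y 0 = ρ + κ
  zero_snd : Z 0 = κ * (√((ρ + κ) ^ 2 - 1 / 12) / (ρ + κ))
  bijOn : BijOn (fun z => ∫ r in (0 : ℝ)..z, v r) (Iic 0) (Iic 0)
  neg : ∀ z < 0, ∫ r in (0 : ℝ)..z, v r < 0
  comp : ∀ z ≤ 0, Y (∫ r in (0 : ℝ)..z, v r) = v z

/-- A branch stays between `ρ` and `ρ + κ`, in either order, and hence away from `0`. -/
lemma pos_of_branch_bounds {ρ κ y : ℝ} (hκ : κ ^ 2 = 1) (hρ : 0 < ρ) (hm : 1 < ρ + κ)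
    (h0 : 0 < κ * (y - ρ)) (h1 : κ * (y - ρ) ≤ 1) : min ρ (ρ + κ) ≤ y ∧ 0 < y := by
  have hcase : κ = 1 ∨ κ = -1 := by simpa using hκ
  rcases hcase with rfl | rfl
  · exact ⟨(min_le_left _ _).trans (by linarith), by linarith⟩
  · exact ⟨(min_le_right _ _).trans (by linarith), by linarith⟩

lemma IsHalfOrbit.exists_isHalfProfile {ρ κ : ℝ} {v V : ℝ → ℝ} (h : IsHalfOrbit ρ κ v V)
    (hκ : κ ^ 2 = 1) (hρ : 0 < ρ) (hm : 1 < ρ + κ) : ∃ Y Z : ℝ → ℝ, IsHalfProfile ρ κ v Y Z := by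
  have hvc (z : ℝ) (hz : z ≤ 0) : ContinuousAt v z := (h.hasDerivAt_fst z hz).continuousAt
  have hVc (z : ℝ) (hz : z ≤ 0) : ContinuousAt V z := (h.hasDerivAt_snd z hz).continuousAt
  have hvpos (z : ℝ) (hz : z ≤ 0) := pos_of_branch_bounds hκ hρ hm (h.pos_fst z hz) (h.le_fst z hz)
  obtain ⟨T, Tc, T0, Tle, Td, Tbot, TH, HT⟩ := exists_inverse_primitive
    (fun z hz => (hvc z hz).continuousWithinAt) (lt_min hρ (by linarith : 0 < ρ + κ))
    (fun z hz => (hvpos z hz).1)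
  have hHle (z : ℝ) (hz : z ≤ 0) : ∫ r in (0 : ℝ)..z, v r ≤ 0 := by
    rw [intervalIntegral.integral_symm, neg_nonpos]
    exact intervalIntegral.integral_nonneg hz fun r hr => (hvpos r hr.2).2.le
  refine ⟨v ∘ T, V ∘ T, ?_, ?_, fun η hη => ?_, fun η hη => ?_, fun η hη => h.pos_fst _ (Tle η hη),
    fun η hη => h.le_fst _ (Tle η hη), h.tendsto_fst.comp Tbot, h.tendsto_snd.comp Tbot,
    by simp [T0, h.zero_fst], by simp [T0, h.zero_snd], ?_, fun z hz => ?_,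
    fun z hz => by simp [TH z hz]⟩
  · exact fun η hη => ((hvc _ (Tle η hη)).comp Tc.continuousAt).continuousWithinAt
  · exact fun η hη => ((hVc _ (Tle η hη)).comp Tc.continuousAt).continuousWithinAt
  · have hne := (hvpos _ (Tle η hη.le)).2.ne'
    refine ((h.hasDerivAt_fst _ (Tle η hη.le)).comp η (Td η hη)).congr_deriv ?_
    simp only [Function.comp]
    field_simp
  · refine ((h.hasDerivAt_snd _ (Tle η hη.le)).comp η (Td η hη)).congr_deriv ?_
    simp only [Function.comp, div_eq_mul_inv]
  · exact ⟨hHle, fun x hx y hy hxy => by rw [← TH x hx, ← TH y hy]; exact congrArg T hxy,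
      fun η hη => ⟨T η, Tle η hη, HT η hη⟩⟩
  · refine (hHle z hz.le).lt_of_ne fun h0 => ?_
    have := TH z hz.le
    rw [h0, T0] at this
    exact hz.ne this.symm

/-! ### Integrals of derivatives with countably many exceptional points -/

lemma integral_Iic_of_hasDerivAt_off_countable {f f' : ℝ → ℝ} {s : Set ℝ} {a : ℝ}
    (hs : s.Countable) (hf : Continuous f) (hd : ∀ x ∉ s, HasDerivAt f (f' x) x)
    (hi : IntegrableOn f' (Iic a)) (h0 : Tendsto f atBot (𝓝 0)) :
    ∫ x in Iic a, f' x = f a := by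
  refine tendsto_nhds_unique (intervalIntegral_tendsto_integral_Iic a hi tendsto_id) ?_
  have h : Tendsto (fun r => f a - f r) atBot (𝓝 (f a)) := by simpa using h0.const_sub (f a)
  refine h.congr' ?_
  filter_upwards [eventually_le_atBot a] with r hr
  refine (integral_eq_of_hasDerivAt_off_countable_of_le f f' hr hs hf.continuousOn
    (fun x hx => hd x hx.2) ?_).symm
  rw [intervalIntegrable_iff_integrableOn_Ioc_of_le hr]
  exact hi.mono_set fun x hx => hx.2

lemma integral_Ioi_of_hasDerivAt_off_countable {f f' : ℝ → ℝ} {s : Set ℝ} {a : ℝ}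
    (hs : s.Countable) (hf : Continuous f) (hd : ∀ x ∉ s, HasDerivAt f (f' x) x)
    (hi : IntegrableOn f' (Ioi a)) (h0 : Tendsto f atTop (𝓝 0)) :
    ∫ x in Ioi a, f' x = -f a := by
  refine tendsto_nhds_unique (intervalIntegral_tendsto_integral_Ioi a hi tendsto_id) ?_
  have h : Tendsto (fun r => f r - f a) atTop (𝓝 (-f a)) := by simpa using h0.sub_const (f a)
  refine h.congr' ?_
  filter_upwards [eventually_ge_atTop a] with r hr
  refine (integral_eq_of_hasDerivAt_off_countable_of_le f f' hr hs hf.continuousOn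
    (fun x hx => hd x hx.2) ?_).symm
  rw [intervalIntegrable_iff_integrableOn_Ioc_of_le hr]
  exact hi.mono_set fun x hx => hx.1

lemma integral_eq_zero_of_hasDerivAt_off_countable {f f' : ℝ → ℝ} {s : Set ℝ}
    (hs : s.Countable) (hf : Continuous f) (hd : ∀ x ∉ s, HasDerivAt f (f' x) x)
    (hi : Integrable f') (hbot : Tendsto f atBot (𝓝 0)) (htop : Tendsto f atTop (𝓝 0)) :
    ∫ x, f' x = 0 := by
  rw [← intervalIntegral.integral_Iic_add_Ioi (b := 0) hi.integrableOn hi.integrableOn,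
    integral_Iic_of_hasDerivAt_off_countable hs hf hd hi.integrableOn hbot,
    integral_Ioi_of_hasDerivAt_off_countable hs hf hd hi.integrableOn htop, add_neg_cancel]

/-! ### The convolution with the derivative of the kernel -/

lemma deriv_kernel_of_pos {x : ℝ} (hx : 0 < x) : deriv kernel x = -(1 / 2) * Real.exp (-x) := by
  have h : HasDerivAt (fun y => (1 / 2) * Real.exp (-y)) (-(1 / 2) * Real.exp (-x)) x :=
    (((hasDerivAt_id x).neg.exp).const_mul (1 / 2)).congr_deriv (by simp)
  refine (h.congr_of_eventuallyEq ?_).deriv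
  filter_upwards [lt_mem_nhds hx] with y hy
  simp [kernel, abs_of_pos hy]

lemma deriv_kernel_of_neg {x : ℝ} (hx : x < 0) : deriv kernel x = 1 / 2 * Real.exp x := by
  have h : HasDerivAt (fun y => (1 / 2) * Real.exp y) (1 / 2 * Real.exp x) x :=
    (Real.hasDerivAt_exp x).const_mul (1 / 2)
  refine (h.congr_of_eventuallyEq ?_).deriv
  filter_upwards [gt_mem_nhds hx] with y hy
  simp [kernel, abs_of_neg hy]

lemma integrable_deriv_kernel : Integrable (deriv kernel) := by
  rw [← integrableOn_univ, ← Iic_union_Ioi (a := (0 : ℝ))]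
  refine IntegrableOn.union ?_ ?_
  · rw [integrableOn_Iic_iff_integrableOn_Iio]
    exact IntegrableOn.congr_fun
      (((integrableOn_exp_Iic 0).mono_set Iio_subset_Iic_self).const_mul (1 / 2))
      (fun x hx => (deriv_kernel_of_neg hx).symm) measurableSet_Iio
  · exact IntegrableOn.congr_fun ((integrableOn_exp_neg_Ioi 0).const_mul (-(1 / 2)))
      (fun x hx => (deriv_kernel_of_pos hx).symm) measurableSet_Ioi

lemma convolutionExistsAt_deriv_kernel {f : ℝ → ℝ} (hf : Measurable f) {M : ℝ}
    (hM : ∀ x, |f x| ≤ M) (x : ℝ) :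
    ConvolutionExistsAt (deriv kernel) f x (ContinuousLinearMap.mul ℝ ℝ) volume :=
  integrable_deriv_kernel.mul_bdd (hf.comp (measurable_const_sub x)).aestronglyMeasurable
    (Eventually.of_forall fun y => hM (x - y))

lemma convK'_comp_sub_right (f : ℝ → ℝ) (a x : ℝ) :
    convK' (fun y => f (y - a)) x = convK' f (x - a) := by
  simp only [convK', convolution_def]
  congr 1 with y
  rw [sub_right_comm]

/-- If `D = E'` and `D' = E + W + K` off the origin, with `D` and `E` continuous everywhere and
convergent at infinity, then `K' ∗ W = -D`: on the two half lines, `e^{s-x} W` and `e^{x-s} W` have the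
antiderivatives `e^{s-x} (D - E - K)` and `e^{x-s} (D + E + K)`. -/
lemma convK'_eq_neg {W D E : ℝ → ℝ} {K M : ℝ} (hW : Measurable W) (hM : ∀ x, |W x| ≤ M)
    (hD : Continuous D) (hE : Continuous E) (dE : ∀ ξ ≠ 0, HasDerivAt E (D ξ) ξ)
    (dD : ∀ ξ ≠ 0, HasDerivAt D (E ξ + W ξ + K) ξ) {D₀ D₁ E₀ E₁ : ℝ}
    (hD₀ : Tendsto D atBot (𝓝 D₀)) (hD₁ : Tendsto D atTop (𝓝 D₁))
    (hE₀ : Tendsto E atBot (𝓝 E₀)) (hE₁ : Tendsto E atTop (𝓝 E₁)) (x : ℝ) :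
    convK' W x = -D x := by
  have hint := (convolutionExistsAt_deriv_kernel hW hM x).integrable_swap
  have hx : convK' W x = ∫ s, deriv kernel (x - s) * W s := by
    rw [convK', convolution_eq_swap]; rfl
  simp only [ContinuousLinearMap.mul_apply'] at hint
  rw [hx, ← intervalIntegral.integral_Iic_add_Ioi (b := x) hint.integrableOn hint.integrableOn]
  have ebot : Tendsto (fun s => Real.exp (s - x)) atBot (𝓝 0) :=
    Real.tendsto_exp_atBot.comp (tendsto_atBot_add_const_right _ (-x) tendsto_id)
  have etop : Tendsto (fun s => Real.exp (x - s)) atTop (𝓝 0) :=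
    Real.tendsto_exp_atBot.comp
      (tendsto_atBot_add_const_left _ x tendsto_neg_atTop_atBot)
  have d1 (s : ℝ) : HasDerivAt (fun s => Real.exp (s - x)) (Real.exp (s - x)) s := by
    simpa using ((hasDerivAt_id s).sub_const x).exp
  have d2 (s : ℝ) : HasDerivAt (fun s => Real.exp (x - s)) (-Real.exp (x - s)) s := by
    simpa using ((hasDerivAt_id s).const_sub x).exp
  have cl : EqOn (fun s => deriv kernel (x - s) * W s)
      (fun s => -(1 / 2) * (Real.exp (s - x) * W s)) (Iio x) := fun s hs => by
    simp only [deriv_kernel_of_pos (sub_pos.2 hs), neg_sub, mul_assoc]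
  have cr : EqOn (fun s => deriv kernel (x - s) * W s)
      (fun s => 1 / 2 * (Real.exp (x - s) * W s)) (Ioi x) := fun s hs => by
    simp only [deriv_kernel_of_neg (sub_neg.2 hs), mul_assoc]
  have left : ∫ s in Iic x, deriv kernel (x - s) * W s
      = -(1 / 2) * (Real.exp (x - x) * (D x - E x - K)) := by
    rw [integral_Iic_eq_integral_Iio, setIntegral_congr_fun measurableSet_Iio cl,
      ← integral_Iic_eq_integral_Iio]
    refine integral_Iic_of_hasDerivAt_off_countable
      (f := fun s => -(1 / 2) * (Real.exp (s - x) * (D s - E s - K)))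
      (s := {0}) (by simp) (by fun_prop) (fun s hs => ?_) ?_ ?_
    · refine (((d1 s).mul (((dD s hs).sub (dE s hs)).sub_const K)).const_mul _).congr_deriv ?_
      simp only [Pi.sub_apply]
      ring
    · rw [integrableOn_Iic_iff_integrableOn_Iio]
      exact hint.integrableOn.congr_fun cl measurableSet_Iio
    · have := (ebot.mul ((hD₀.sub hE₀).sub_const K)).const_mul (-(1 / 2))
      rwa [zero_mul, mul_zero] at this
  have right : ∫ s in Ioi x, deriv kernel (x - s) * W s
      = -(1 / 2 * (Real.exp (x - x) * (D x + E x + K))) := by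
    rw [setIntegral_congr_fun measurableSet_Ioi cr]
    refine integral_Ioi_of_hasDerivAt_off_countable
      (f := fun s => 1 / 2 * (Real.exp (x - s) * (D s + E s + K)))
      (s := {0}) (by simp) (by fun_prop) (fun s hs => ?_)
      (hint.integrableOn.congr_fun cr measurableSet_Ioi) ?_
    · refine (((d2 s).mul (((dD s hs).add (dE s hs)).add_const K)).const_mul _).congr_deriv ?_
      simp only [Pi.add_apply]
      ring
    · have := (etop.mul ((hD₁.add hE₁).add_const K)).const_mul (1 / 2)
      rwa [zero_mul, mul_zero] at this
  rw [left, right, sub_self, Real.exp_zero]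
  ring

/-! ### The weak formulation -/

lemma isClosedEmbedding_slice_fst (a t : ℝ) : IsClosedEmbedding fun y : ℝ => (y + a, t) :=
  Function.LeftInverse.isClosedEmbedding (f := fun p : ℝ × ℝ => p.1 - a)
    (fun y => by simp) (by fun_prop) (by fun_prop)

lemma isClosedEmbedding_slice_snd (c y : ℝ) : IsClosedEmbedding fun t : ℝ => (y + c * t, t) :=
  Function.LeftInverse.isClosedEmbedding (f := fun p : ℝ × ℝ => p.2)
    (fun y => by simp) (by fun_prop) (by fun_prop)

lemma isClosedEmbedding_shear (c : ℝ) :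
    IsClosedEmbedding fun p : ℝ × ℝ => (p.1 + c * p.2, p.2) :=
  Function.LeftInverse.isClosedEmbedding (f := fun p : ℝ × ℝ => (p.1 - c * p.2, p.2))
    (fun y => by simp) (by fun_prop) (by fun_prop)

namespace IsTestFunction

variable {φ : ℝ × ℝ → ℝ}

lemma continuous_fderiv (hφ : IsTestFunction φ) (w : ℝ × ℝ) :
    Continuous fun p => fderiv ℝ φ p w :=
  (hφ.1.continuous_fderiv (by simp)).clm_apply continuous_const

lemma hasCompactSupport_fderiv (hφ : IsTestFunction φ) (w : ℝ × ℝ) :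
    HasCompactSupport fun p => fderiv ℝ φ p w :=
  hφ.2.fderiv_apply (𝕜 := ℝ) w

lemma integrable_fderiv (hφ : IsTestFunction φ) (w : ℝ × ℝ) :
    Integrable fun p => fderiv ℝ φ p w :=
  (hφ.continuous_fderiv w).integrable_of_hasCompactSupport (hφ.hasCompactSupport_fderiv w)

lemma hasDerivAt_comp (hφ : IsTestFunction φ) {γ : ℝ → ℝ × ℝ} {w : ℝ × ℝ} {s : ℝ}
    (hγ : HasDerivAt γ w s) : HasDerivAt (fun s => φ (γ s)) (fderiv ℝ φ (γ s) w) s :=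
  ((hφ.1.differentiable (by simp)) (γ s)).hasFDerivAt.comp_hasDerivAt s hγ

lemma weakIntegrand_eq (hφ : IsTestFunction φ) {W D : ℝ → ℝ} {c : ℝ}
    (hconv : ∀ x, convK' W x = -D x) (x t : ℝ) :
    weakIntegrand (fun x t => W (x - c * t)) φ x t
      = -(W (x - c * t) * fderiv ℝ φ (x, t) (0, 1))
        - W (x - c * t) ^ 2 / 2 * fderiv ℝ φ (x, t) (1, 0) - D (x - c * t) * φ (x, t) := by
  rw [weakIntegrand, convK'_comp_sub_right, hconv,
    (hφ.hasDerivAt_comp ((hasDerivAt_const t x).prodMk (hasDerivAt_id' t))).deriv,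
    (hφ.hasDerivAt_comp ((hasDerivAt_id' x).prodMk (hasDerivAt_const x t))).deriv]
  ring

end IsTestFunction

/-- Along `x = y + c t` the weak integrand is `-W ∂ₜ[φ(y + c t, t)]` minus the `y`-derivative of
`(E - c² / 2) φ(y + c t, t)`, where `E = (W - c)² / 2`. The second term integrates to zero because
`E` is continuous across the jump of `W`. -/
lemma isWeakSolution_of_profile {W D : ℝ → ℝ} {c M : ℝ} (hW : Measurable W)
    (hM : ∀ x, |W x| ≤ M) (hD : Continuous D) (hE : Continuous fun ξ => (W ξ - c) ^ 2 / 2)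
    (dE : ∀ ξ ≠ 0, HasDerivAt (fun ξ => (W ξ - c) ^ 2 / 2) (D ξ) ξ)
    (hconv : ∀ x, convK' W x = -D x) :
    IsWeakSolution (fun x t => W (x - c * t)) W where
  locBounded := by
    have hm : Measurable fun p : ℝ × ℝ => W (p.1 - c * p.2) := hW.comp (by fun_prop)
    exact ⟨hm.aestronglyMeasurable, fun C _ _ =>
      memLp_top_of_bound hm.aestronglyMeasurable M (Eventually.of_forall fun p => hM _)⟩
  locBounded_init := ⟨hW.aestronglyMeasurable, fun C _ _ =>
    memLp_top_of_bound hW.aestronglyMeasurable M (Eventually.of_forall hM)⟩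
  convolution_exists := Eventually.of_forall fun p _ =>
    convolutionExistsAt_deriv_kernel (hW.comp (measurable_sub_const _)) (fun x => hM _) _
  integrable φ hφ := by
    have hWm : Measurable fun p : ℝ × ℝ => W (p.1 - c * p.2) := hW.comp (by fun_prop)
    have hW2 : Measurable fun p : ℝ × ℝ => W (p.1 - c * p.2) ^ 2 / 2 :=
      (hWm.pow_const 2).div_const 2
    have h1 := (hφ.integrable_fderiv (0, 1)).bdd_mul (c := M) hWm.aestronglyMeasurable
      (Eventually.of_forall fun p => hM _)
    have h2 := (hφ.integrable_fderiv (1, 0)).bdd_mul (c := M ^ 2 / 2) hW2.aestronglyMeasurable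
      (Eventually.of_forall fun p => by
        rw [Real.norm_eq_abs, abs_div, abs_pow, abs_two]
        have := hM (p.1 - c * p.2)
        gcongr)
    have h3 : Integrable fun p : ℝ × ℝ => D (p.1 - c * p.2) * φ p :=
      Continuous.integrable_of_hasCompactSupport
        ((hD.comp (by fun_prop)).mul hφ.1.continuous) hφ.2.mul_left
    refine Integrable.integrableOn (((h1.neg.sub h2).sub h3).congr (Eventually.of_forall fun p => ?_))
    simp only [hφ.weakIntegrand_eq hconv]
    rfl
  weak_eq φ hφ := by
    have hslice (t : ℝ) : ∫ x, weakIntegrand (fun x t => W (x - c * t)) φ x t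
        = ∫ y, -(W y * fderiv ℝ φ (y + c * t, t) (c, 1)) := by
      rw [← integral_add_right_eq_self _ (c * t)]
      have hcl := isClosedEmbedding_slice_fst (c * t) t
      have i1 : Integrable fun y => -(W y * fderiv ℝ φ (y + c * t, t) (c, 1)) :=
        (((hφ.continuous_fderiv (c, 1)).comp hcl.continuous).integrable_of_hasCompactSupport
          ((hφ.hasCompactSupport_fderiv (c, 1)).comp_isClosedEmbedding hcl)).bdd_mul
          hW.aestronglyMeasurable (Eventually.of_forall hM) |>.neg
      have hc0 : Continuous fun y => φ (y + c * t, t) := hφ.1.continuous.comp hcl.continuous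
      have hs0 : HasCompactSupport fun y => φ (y + c * t, t) := hφ.2.comp_isClosedEmbedding hcl
      have hc1 : Continuous fun y => fderiv ℝ φ (y + c * t, t) (1, 0) :=
        (hφ.continuous_fderiv (1, 0)).comp hcl.continuous
      have hs1 : HasCompactSupport fun y => fderiv ℝ φ (y + c * t, t) (1, 0) :=
        (hφ.hasCompactSupport_fderiv (1, 0)).comp_isClosedEmbedding hcl
      have hEc : Continuous fun y => (W y - c) ^ 2 / 2 - c ^ 2 / 2 := hE.sub continuous_const
      have i2 : Integrable fun y => D y * φ (y + c * t, t)
          + ((W y - c) ^ 2 / 2 - c ^ 2 / 2) * fderiv ℝ φ (y + c * t, t) (1, 0) :=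
        ((hD.mul hc0).integrable_of_hasCompactSupport hs0.mul_left).add
          ((hEc.mul hc1).integrable_of_hasCompactSupport hs1.mul_left)
      have hlim := (hs0.mul_left (f := fun y => (W y - c) ^ 2 / 2 - c ^ 2 / 2)).is_zero_at_infty
      have h0 := integral_eq_zero_of_hasDerivAt_off_countable (countable_singleton (0 : ℝ))
        (hEc.mul hc0) (fun y hy => ((dE y hy).sub_const (c ^ 2 / 2)).mul
          (hφ.hasDerivAt_comp (((hasDerivAt_id y).add_const (c * t)).prodMk
            (hasDerivAt_const y t)))) i2 (hlim.mono_left atBot_le_cocompact)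
        (hlim.mono_left atTop_le_cocompact)
      rw [← sub_zero (∫ y, -(W y * _)), ← h0, ← integral_sub i1 i2]
      refine integral_congr_ae (Eventually.of_forall fun y => ?_)
      have hlin : fderiv ℝ φ (y + c * t, t) (c, 1) = c * fderiv ℝ φ (y + c * t, t) (1, 0)
          + fderiv ℝ φ (y + c * t, t) (0, 1) := by
        have hw : ((c, 1) : ℝ × ℝ) = c • (1, 0) + (0, 1) := by simp
        rw [hw, map_add, map_smul, smul_eq_mul]
      simp only [hφ.weakIntegrand_eq hconv, hlin, add_sub_cancel_right]
      ring
    simp only [hslice]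
    have hcl (y : ℝ) := isClosedEmbedding_slice_snd c y
    have hshear := isClosedEmbedding_shear c
    have hint : Integrable fun p : ℝ × ℝ => -(W p.1 * fderiv ℝ φ (p.1 + c * p.2, p.2) (c, 1)) :=
      (((hφ.continuous_fderiv (c, 1)).comp hshear.continuous).integrable_of_hasCompactSupport
        ((hφ.hasCompactSupport_fderiv (c, 1)).comp_isClosedEmbedding hshear)).bdd_mul
        (hW.comp measurable_fst).aestronglyMeasurable (Eventually.of_forall fun p => hM p.1) |>.neg
    rw [integral_integral_swap]
    · refine integral_congr_ae (Eventually.of_forall fun y => ?_)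
      have hc0 : Continuous fun t => φ (y + c * t, t) := hφ.1.continuous.comp (hcl y).continuous
      have hs0 : HasCompactSupport fun t => φ (y + c * t, t) := hφ.2.comp_isClosedEmbedding (hcl y)
      have h := integral_Ioi_of_hasDerivAt_off_countable (a := 0) countable_empty hc0
        (fun t _ => hφ.hasDerivAt_comp ((((hasDerivAt_id t).const_mul c).const_add y).prodMk
            (hasDerivAt_id t)))
        (((hφ.continuous_fderiv (c * 1, 1)).comp (hcl y).continuous).integrable_of_hasCompactSupport
          ((hφ.hasCompactSupport_fderiv _).comp_isClosedEmbedding (hcl y))).integrableOn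
        (hs0.is_zero_at_infty.mono_left atTop_le_cocompact)
      simp only [mul_one, mul_zero, add_zero] at h
      simp only [integral_neg, integral_const_mul, h]
      ring
    · have h := hint.swap.restrict (s := Ioi 0 ×ˢ univ)
      rwa [← Measure.prod_restrict, Measure.restrict_univ] at h

/-! ### Functions glued at the origin -/

/-- The function equal to `f` on `(-∞, 0]` and to the reflection `ξ ↦ g (-ξ)` of `g` on `(0, ∞)`.
Only the values of `f` and `g` on `(-∞, 0]` matter. -/
noncomputable def glue (f g : ℝ → ℝ) (ξ : ℝ) : ℝ := if ξ ≤ 0 then f ξ else g (-ξ)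

lemma glue_of_nonpos {f g : ℝ → ℝ} {ξ : ℝ} (h : ξ ≤ 0) : glue f g ξ = f ξ := if_pos h

lemma glue_of_pos {f g : ℝ → ℝ} {ξ : ℝ} (h : 0 < ξ) : glue f g ξ = g (-ξ) := if_neg h.not_ge

/-- Freezing the pieces at `0` makes each of them continuous on the whole line when it is continuous
on `(-∞, 0]`. -/
lemma glue_eq_min (f g : ℝ → ℝ) :
    glue f g = fun ξ => if ξ ≤ 0 then f (min ξ 0) else g (min (-ξ) 0) := by
  ext ξ
  rcases le_or_gt ξ 0 with h | h
  · simp [glue, h]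
  · simp [glue, h.not_ge, h.le]

lemma measurable_glue {f g : ℝ → ℝ} (hf : ContinuousOn f (Iic 0))
    (hg : ContinuousOn g (Iic 0)) : Measurable (glue f g) := by
  rw [glue_eq_min]
  exact Measurable.ite measurableSet_Iic
    (hf.comp_continuous (by fun_prop) fun ξ => min_le_right ξ 0).measurable
    (hg.comp_continuous (by fun_prop) fun ξ => min_le_right (-ξ) 0).measurable

lemma continuous_glue {f g : ℝ → ℝ} (hf : ContinuousOn f (Iic 0))
    (hg : ContinuousOn g (Iic 0)) (h0 : f 0 = g 0) : Continuous (glue f g) := by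
  rw [glue_eq_min]
  refine Continuous.if_le (hf.comp_continuous (by fun_prop) fun ξ => min_le_right ξ 0)
    (hg.comp_continuous (by fun_prop) fun ξ => min_le_right (-ξ) 0) continuous_id continuous_const ?_
  rintro ξ rfl
  simpa using h0

lemma tendsto_glue_left {f : ℝ → ℝ} (hf : ContinuousOn f (Iic 0)) (g : ℝ → ℝ) :
    Tendsto (glue f g) (𝓝[<] 0) (𝓝 (f 0)) := by
  refine ((hf 0 self_mem_Iic).tendsto.mono_left (nhdsWithin_mono _ Iio_subset_Iic_self)).congr' ?_
  filter_upwards [self_mem_nhdsWithin] with ξ hξ using (glue_of_nonpos (le_of_lt hξ)).symm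

lemma tendsto_glue_right (f : ℝ → ℝ) {g : ℝ → ℝ} (hg : ContinuousOn g (Iic 0)) :
    Tendsto (glue f g) (𝓝[>] 0) (𝓝 (g 0)) := by
  have h : Tendsto (fun ξ : ℝ => -ξ) (𝓝[>] 0) (𝓝[≤] 0) := by
    refine tendsto_nhdsWithin_iff.2 ⟨?_, ?_⟩
    · simpa using (continuous_neg.tendsto (0 : ℝ)).mono_left nhdsWithin_le_nhds
    · filter_upwards [self_mem_nhdsWithin] with ξ hξ
      simpa using le_of_lt hξ
  refine ((hg 0 self_mem_Iic).tendsto.comp h).congr' ?_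
  filter_upwards [self_mem_nhdsWithin] with ξ hξ using (glue_of_pos hξ).symm

lemma hasOneSidedLimits_glue {f g : ℝ → ℝ} (hf : ContinuousOn f (Iic 0))
    (hg : ContinuousOn g (Iic 0)) : HasOneSidedLimits (glue f g) :=
  ⟨⟨_, tendsto_glue_left hf g⟩, _, tendsto_glue_right f hg⟩

lemma continuousOn_glue {f g : ℝ → ℝ} (hf : ContinuousOn f (Iic 0))
    (hg : ContinuousOn g (Iic 0)) : ContinuousOn (glue f g) {0}ᶜ := by
  intro ξ hξ
  refine ContinuousAt.continuousWithinAt ?_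
  rcases lt_or_gt_of_ne hξ with h | h
  · refine (hf.continuousAt (Iic_mem_nhds h)).congr ?_
    filter_upwards [gt_mem_nhds h] with x hx using (glue_of_nonpos hx.le).symm
  · have : ContinuousAt (fun x => g (-x)) ξ :=
      ContinuousAt.comp (hg.continuousAt (Iic_mem_nhds (by linarith))) continuous_neg.continuousAt
    refine this.congr ?_
    filter_upwards [lt_mem_nhds h] with x hx using (glue_of_pos hx).symm

lemma hasDerivAt_glue {f g f' g' : ℝ → ℝ} (hf : ∀ ξ < 0, HasDerivAt f (f' ξ) ξ)
    (hg : ∀ ξ < 0, HasDerivAt g (g' ξ) ξ) {ξ : ℝ} (hξ : ξ ≠ 0) :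
    HasDerivAt (glue f g) (glue f' (fun η => -g' η) ξ) ξ := by
  rcases lt_or_gt_of_ne hξ with h | h
  · rw [glue_of_nonpos h.le]
    refine (hf ξ h).congr_of_eventuallyEq ?_
    filter_upwards [gt_mem_nhds h] with x hx using glue_of_nonpos hx.le
  · rw [glue_of_pos h]
    have := (hg (-ξ) (by linarith)).comp ξ (hasDerivAt_neg ξ)
    rw [mul_neg_one] at this
    refine this.congr_of_eventuallyEq ?_
    filter_upwards [lt_mem_nhds h] with x hx using glue_of_pos hx

lemma tendsto_glue_atBot {f g : ℝ → ℝ} {l : ℝ} (hf : Tendsto f atBot (𝓝 l)) :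
    Tendsto (glue f g) atBot (𝓝 l) := by
  refine hf.congr' ?_
  filter_upwards [eventually_le_atBot 0] with ξ hξ using (glue_of_nonpos hξ).symm

lemma tendsto_glue_atTop {f g : ℝ → ℝ} {l : ℝ} (hg : Tendsto g atBot (𝓝 l)) :
    Tendsto (glue f g) atTop (𝓝 l) := by
  refine (hg.comp tendsto_neg_atTop_atBot).congr' ?_
  filter_upwards [eventually_gt_atTop 0] with ξ hξ using (glue_of_pos hξ).symm

lemma isPiecewiseC2_of_hasDerivAt {W W₁ W₂ : ℝ → ℝ} (h₁ : ∀ ξ ≠ 0, HasDerivAt W (W₁ ξ) ξ)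
    (h₂ : ∀ ξ ≠ 0, HasDerivAt W₁ (W₂ ξ) ξ) (hc : ContinuousOn W₂ {0}ᶜ)
    (l : HasOneSidedLimits W) (l₁ : HasOneSidedLimits W₁) (l₂ : HasOneSidedLimits W₂) :
    IsPiecewiseC2 W := by
  have e₁ : EqOn (deriv W) W₁ {0}ᶜ := fun ξ hξ => (h₁ ξ hξ).deriv
  have e₂ : EqOn (deriv (deriv W)) W₂ {0}ᶜ := fun ξ hξ => by
    rw [← (h₂ ξ hξ).deriv]
    exact (e₁.eventuallyEq_of_mem (isOpen_compl_singleton.mem_nhds hξ)).deriv_eq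
  have transfer {f g : ℝ → ℝ} (h : EqOn f g {0}ᶜ) (hg : HasOneSidedLimits g) :
      HasOneSidedLimits f := by
    obtain ⟨⟨x, hx⟩, y, hy⟩ := hg
    refine ⟨⟨x, hx.congr' ?_⟩, y, hy.congr' ?_⟩
    · filter_upwards [self_mem_nhdsWithin] with ξ hξ using (h (ne_of_lt hξ)).symm
    · filter_upwards [self_mem_nhdsWithin] with ξ hξ using (h (ne_of_gt hξ)).symm
  refine ⟨?_, l, transfer e₁ l₁, transfer e₂ l₂⟩
  rw [show (2 : WithTop ℕ∞) = 1 + 1 by norm_num,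
    contDiffOn_succ_iff_deriv_of_isOpen isOpen_compl_singleton]
  refine ⟨fun ξ hξ => (h₁ ξ hξ).differentiableAt.differentiableWithinAt, by simp, ?_⟩
  rw [show (1 : WithTop ℕ∞) = 0 + 1 by norm_num,
    contDiffOn_succ_iff_deriv_of_isOpen isOpen_compl_singleton]
  refine ⟨DifferentiableOn.congr
    (fun ξ hξ => (h₂ ξ hξ).differentiableAt.differentiableWithinAt) e₁, by simp, ?_⟩
  exact contDiffOn_zero.2 (hc.congr e₂)

/-! ### The planar system -/

lemma isSaddle_of_pos {c α U : ℝ} (h0 : U ^ 2 / 2 + (1 - c) * U + c ^ 2 / 2 - α = 0)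
    (hpos : 0 < (U - c) * (U + 1 - c)) : IsSaddle (field c α) (U, 0) := by
  have hUc : U - c ≠ 0 := left_ne_zero_of_mul hpos.ne'
  refine ⟨by simp only [field, mul_zero, Prod.mk_eq_zero, true_and]; linarith, ?_⟩
  set L : ℝ × ℝ →L[ℝ] ℝ × ℝ := ((U - c) • ContinuousLinearMap.snd ℝ ℝ ℝ).prod
    ((U + 1 - c) • ContinuousLinearMap.fst ℝ ℝ ℝ) with hL
  have hfst : HasFDerivAt (fun p : ℝ × ℝ => p.1) (ContinuousLinearMap.fst ℝ ℝ ℝ) (U, 0) :=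
    hasFDerivAt_fst
  have hsnd : HasFDerivAt (fun p : ℝ × ℝ => p.2) (ContinuousLinearMap.snd ℝ ℝ ℝ) (U, 0) :=
    hasFDerivAt_snd
  refine ⟨L, ?_, ?_⟩
  · have h1 := (hfst.sub_const c).mul hsnd
    have h2 := (((((hsnd.pow 2).neg).add ((hfst.pow 2).mul_const (1 / 2))).add
      (hfst.const_mul (1 - c))).add_const (c ^ 2 / 2)).sub_const α
    refine (h1.prodMk h2).congr_fderiv ?_ |>.congr_of_eventuallyEq ?_
    · ext <;> simp [hL]; ring
    · refine Eventually.of_forall fun p => ?_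
      simp [field]; ring
  -- An eigenvector for `μ` is `(U - c, μ)`.
  have key (μ : ℝ) (hμ : μ ^ 2 = (U - c) * (U + 1 - c)) :
      Module.End.HasEigenvalue (L : ℝ × ℝ →ₗ[ℝ] ℝ × ℝ) μ := by
    refine Module.End.hasEigenvalue_of_hasEigenvector (x := (U - c, μ)) ⟨?_, ?_⟩
    · rw [Module.End.mem_eigenspace_iff]
      ext
      · simp [hL]; ring
      · simp [hL]; linarith
    · simp [hUc]
  have hs : √((U - c) * (U + 1 - c)) ^ 2 = (U - c) * (U + 1 - c) := Real.sq_sqrt hpos.le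
  exact ⟨⟨-√((U - c) * (U + 1 - c)), neg_lt_zero.2 (Real.sqrt_pos.2 hpos), key _ (by rwa [neg_sq])⟩,
    √((U - c) * (U + 1 - c)), Real.sqrt_pos.2 hpos, key _ hs⟩

lemma IsHalfOrbit.isOrbitFrom {ρ κ c α : ℝ} {v V : ℝ → ℝ} (h : IsHalfOrbit ρ κ v V)
    (hκ : κ ^ 2 = 1)
    (hα : (c + κ * ρ) ^ 2 / 2 + (1 - c) * (c + κ * ρ) + c ^ 2 / 2 - α = 0) :
    IsOrbitFrom (field c α) (c + κ * ρ, 0) (fun z => (c + κ * v z, V z)) 0 := by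
  refine ⟨fun z hz => HasDerivAt.hasDerivWithinAt ?_,
    ((h.tendsto_fst.const_mul κ).const_add c).prodMk_nhds h.tendsto_snd⟩
  refine ((((h.hasDerivAt_fst z hz).const_mul κ).const_add c).prodMk
    (h.hasDerivAt_snd z hz)).congr_deriv ?_
  ext
  · simp only [field]; ring
  · simp only [field]
    linear_combination -hα - (v z ^ 2 - ρ ^ 2) / 2 * hκ

lemma coord_zero (c κ : ℝ) (v V : ℝ → ℝ) :
    coord c (fun z => (c + κ * v z, V z)) 0 = fun z => κ * ∫ r in (0 : ℝ)..z, v r := by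
  ext z
  simp [coord]

/-! ### The travelling wave -/

/-- The rate of change of `Z` along a half profile, as a function of the coordinate. -/
noncomputable def profileRate (ρ κ : ℝ) (Y Z : ℝ → ℝ) (η : ℝ) : ℝ :=
  (-Z η ^ 2 + (Y η - ρ) * (Y η + ρ + 2 * κ) / 2) / Y η

/-- The wave profile `W`: the left piece is `c + Y₁`, the right piece the reflection of `c - Y₂`. Its
value at `0` is the left limit, so that `(W - c)² / 2` is continuous at `0`. -/
noncomputable def wave (c : ℝ) (Y₁ Y₂ : ℝ → ℝ) : ℝ → ℝ :=
  glue (fun η => c + Y₁ η) (fun η => c - Y₂ η)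

lemma hasDerivAt_wave {a c : ℝ} {v₁ v₂ Y₁ Z₁ Y₂ Z₂ : ℝ → ℝ} (h₁ : IsHalfProfile a 1 v₁ Y₁ Z₁)
    (h₂ : IsHalfProfile (a + 2) (-1) v₂ Y₂ Z₂) {ξ : ℝ} (hξ : ξ ≠ 0) :
    HasDerivAt (wave c Y₁ Y₂) (glue Z₁ Z₂ ξ) ξ := by
  have := hasDerivAt_glue (fun η hη => (h₁.hasDerivAt_fst η hη).const_add c)
    (fun η hη => (h₂.hasDerivAt_fst η hη).const_sub c) hξ
  simp only [neg_neg] at this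
  exact this

lemma isPiecewiseC2_wave {a c : ℝ} {v₁ v₂ Y₁ Z₁ Y₂ Z₂ : ℝ → ℝ}
    (ha : 0 < a) (h₁ : IsHalfProfile a 1 v₁ Y₁ Z₁)
    (h₂ : IsHalfProfile (a + 2) (-1) v₂ Y₂ Z₂) : IsPiecewiseC2 (wave c Y₁ Y₂) := by
  have c₁ : ContinuousOn (profileRate a 1 Y₁ Z₁) (Iic 0) := by
    have := h₁.continuousOn_fst
    have := h₁.continuousOn_snd
    refine ContinuousOn.div (by fun_prop) (by fun_prop) fun η hη => ?_
    exact (pos_of_branch_bounds (by norm_num) ha (by linarith) (h₁.pos_fst η hη)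
      (h₁.le_fst η hη)).2.ne'
  have c₂ : ContinuousOn (fun η => -profileRate (a + 2) (-1) Y₂ Z₂ η) (Iic 0) := by
    have := h₂.continuousOn_fst
    have := h₂.continuousOn_snd
    refine (ContinuousOn.div (by fun_prop) (by fun_prop) fun η hη => ?_).neg
    exact (pos_of_branch_bounds (by norm_num) (by linarith) (by linarith) (h₂.pos_fst η hη)
      (h₂.le_fst η hη)).2.ne'
  exact isPiecewiseC2_of_hasDerivAt (fun ξ hξ => hasDerivAt_wave h₁ h₂ hξ)
    (fun ξ hξ => hasDerivAt_glue h₁.hasDerivAt_snd h₂.hasDerivAt_snd hξ) (continuousOn_glue c₁ c₂)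
    (hasOneSidedLimits_glue (continuousOn_const.add h₁.continuousOn_fst)
      (continuousOn_const.sub h₂.continuousOn_fst))
    (hasOneSidedLimits_glue h₁.continuousOn_snd h₂.continuousOn_snd)
    (hasOneSidedLimits_glue c₁ c₂)

lemma hasJump_wave {a c : ℝ} {v₁ v₂ Y₁ Z₁ Y₂ Z₂ : ℝ → ℝ}
    (ha : 0 < a) (h₁ : IsHalfProfile a 1 v₁ Y₁ Z₁)
    (h₂ : IsHalfProfile (a + 2) (-1) v₂ Y₂ Z₂) : HasJump (wave c Y₁ Y₂) := by
  refine ⟨_, _,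
    tendsto_glue_left (f := fun η => c + Y₁ η) (continuousOn_const.add h₁.continuousOn_fst) _,
    tendsto_glue_right _ (continuousOn_const.sub h₂.continuousOn_fst), ?_⟩
  simp only [h₁.zero_fst, h₂.zero_fst]
  intro h
  linarith

/-- With `w = W - c`, both half profiles satisfy `(w W')' = w² / 2 + w - a (a + 2) / 2`, that is,
`D' = E + W + K` with the same constant `K = -c - a (a + 2) / 2` on the two sides of the jump. -/
lemma isWeakSolution_wave {a c : ℝ} {v₁ v₂ Y₁ Z₁ Y₂ Z₂ : ℝ → ℝ}
    (ha : 0 < a) (h₁ : IsHalfProfile a 1 v₁ Y₁ Z₁)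
    (h₂ : IsHalfProfile (a + 2) (-1) v₂ Y₂ Z₂) :
    IsWeakSolution (fun x t => wave c Y₁ Y₂ (x - c * t)) (wave c Y₁ Y₂) := by
  have Y₁c := h₁.continuousOn_fst
  have Y₂c := h₂.continuousOn_fst
  have Z₁c := h₁.continuousOn_snd
  have Z₂c := h₂.continuousOn_snd
  have Y₁pos (η : ℝ) (hη : η ≤ 0) := (pos_of_branch_bounds (by norm_num) ha (by linarith)
    (h₁.pos_fst η hη) (h₁.le_fst η hη)).2
  have Y₂pos (η : ℝ) (hη : η ≤ 0) := (pos_of_branch_bounds (by norm_num) (by linarith) (by linarith)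
    (h₂.pos_fst η hη) (h₂.le_fst η hη)).2
  have hW : Measurable (wave c Y₁ Y₂) :=
    measurable_glue (continuousOn_const.add Y₁c) (continuousOn_const.sub Y₂c)
  have hM (ξ : ℝ) : |wave c Y₁ Y₂ ξ| ≤ |c| + (a + 2) := by
    rw [wave]
    rcases le_or_gt ξ 0 with h | h
    · rw [glue_of_nonpos h]
      refine (abs_add_le _ _).trans ?_
      rw [abs_of_pos (Y₁pos ξ h)]
      linarith [h₁.le_fst ξ h]
    · rw [glue_of_pos h]
      refine (abs_sub _ _).trans ?_
      rw [abs_of_pos (Y₂pos (-ξ) (by linarith))]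
      linarith [h₂.pos_fst (-ξ) (by linarith)]
  have eE : (fun ξ => (wave c Y₁ Y₂ ξ - c) ^ 2 / 2)
      = glue (fun η => Y₁ η ^ 2 / 2) (fun η => Y₂ η ^ 2 / 2) := by
    ext ξ
    rcases le_or_gt ξ 0 with h | h
    · simp only [wave, glue_of_nonpos h]; ring
    · simp only [wave, glue_of_pos h]; ring
  -- The two half profiles reach `η = 0` at the same height and with opposite slopes.
  have e₁ : Y₁ 0 = Y₂ 0 := by rw [h₁.zero_fst, h₂.zero_fst]; ring
  have e₂ : Z₁ 0 = -Z₂ 0 := by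
    rw [h₁.zero_snd, h₂.zero_snd, show a + 2 + -1 = a + 1 by ring]; ring
  have hE : Continuous fun ξ => (wave c Y₁ Y₂ ξ - c) ^ 2 / 2 := by
    rw [eE]
    exact continuous_glue (by fun_prop) (by fun_prop) (by rw [e₁])
  have hD : Continuous (glue (fun η => Y₁ η * Z₁ η) (fun η => -(Y₂ η * Z₂ η))) :=
    continuous_glue (by fun_prop) (by fun_prop) (by rw [e₁, e₂]; ring)
  have dE (ξ : ℝ) (hξ : ξ ≠ 0) : HasDerivAt (fun ξ => (wave c Y₁ Y₂ ξ - c) ^ 2 / 2)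
      (glue (fun η => Y₁ η * Z₁ η) (fun η => -(Y₂ η * Z₂ η)) ξ) ξ := by
    refine (((((hasDerivAt_wave h₁ h₂ hξ).sub_const c).pow 2)).div_const 2).congr_deriv ?_
    rcases le_or_gt ξ 0 with h | h
    · simp only [wave, glue_of_nonpos h]; simp; ring
    · simp only [wave, glue_of_pos h]; simp; ring
  have dD (ξ : ℝ) (hξ : ξ ≠ 0) : HasDerivAt (glue (fun η => Y₁ η * Z₁ η) (fun η => -(Y₂ η * Z₂ η)))
      ((wave c Y₁ Y₂ ξ - c) ^ 2 / 2 + wave c Y₁ Y₂ ξ + (-c - a * (a + 2) / 2)) ξ := by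
    refine (hasDerivAt_glue
      (fun η hη => (h₁.hasDerivAt_fst η hη).mul (h₁.hasDerivAt_snd η hη))
      (fun η hη => ((h₂.hasDerivAt_fst η hη).mul (h₂.hasDerivAt_snd η hη)).neg) hξ).congr_deriv ?_
    rcases le_or_gt ξ 0 with h | h
    · have := (Y₁pos ξ h).ne'
      simp only [wave, glue_of_nonpos h]; field_simp; ring
    · have := (Y₂pos (-ξ) (by linarith)).ne'
      simp only [wave, glue_of_pos h]; field_simp; ring
  have lD₀ := tendsto_glue_atBot (g := fun η => -(Y₂ η * Z₂ η)) (h₁.tendsto_fst.mul h₁.tendsto_snd)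
  have lD₁ := tendsto_glue_atTop (f := fun η => Y₁ η * Z₁ η) (h₂.tendsto_fst.mul h₂.tendsto_snd).neg
  have lE₀ := tendsto_glue_atBot (g := fun η => Y₂ η ^ 2 / 2) ((h₁.tendsto_fst.pow 2).div_const 2)
  have lE₁ := tendsto_glue_atTop (f := fun η => Y₁ η ^ 2 / 2) ((h₂.tendsto_fst.pow 2).div_const 2)
  rw [← eE] at lE₀ lE₁
  exact isWeakSolution_of_profile hW hM hD hE dE
    (convK'_eq_neg hW hM hD hE dE dD lD₀ lD₁ lE₀ lE₁)

lemma isPatched_wave {a c : ℝ} {v₁ v₂ V₁ V₂ Y₁ Z₁ Y₂ Z₂ : ℝ → ℝ} (ha : 0 < a)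
    (h₁ : IsHalfProfile a 1 v₁ Y₁ Z₁)
    (h₂ : IsHalfProfile (a + 2) (-1) v₂ Y₂ Z₂) (o₁ : IsHalfOrbit a 1 v₁ V₁)
    (o₂ : IsHalfOrbit (a + 2) (-1) v₂ V₂) :
    IsPatched (c + a) (c - (a + 2)) c (a ^ 2 / 2 + (c + a)) (wave c Y₁ Y₂)
      (fun z => (c + 1 * v₁ z, V₁ z)) (fun z => (c + -1 * v₂ z, V₂ z)) 0 0 where
  orbit_left := by
    have := o₁.isOrbitFrom (c := c) (α := a ^ 2 / 2 + (c + a)) (by norm_num) (by ring)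
    rwa [one_mul] at this
  region_left z hz := ⟨by linarith [o₁.pos_fst z hz], by linarith [o₁.pos_snd z hz]⟩
  orbit_right := by
    have := o₂.isOrbitFrom (c := c) (α := a ^ 2 / 2 + (c + a)) (by norm_num) (by ring)
    rwa [neg_one_mul, ← sub_eq_add_neg] at this
  region_right z hz := by
    have h := o₂.pos_fst z hz
    have h' := o₂.le_fst z hz
    exact ⟨by linarith, by linarith, by linarith [o₂.pos_snd z hz]⟩
  match_fst := by
    simp only [o₁.zero_fst, o₂.zero_fst]; ring
  match_snd := by
    simp only [o₁.zero_snd, o₂.zero_snd, show a + 2 + -1 = a + 1 by ring]; ring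
  bijOn_left := by
    rw [coord_zero]
    simpa only [one_mul] using h₁.bijOn
  bijOn_right := by
    rw [coord_zero]
    have hneg : BijOn (fun x : ℝ => -x) (Iic 0) (Ici 0) :=
      ⟨fun x hx => neg_nonneg.2 (mem_Iic.1 hx), neg_injective.injOn,
        fun x hx => ⟨-x, neg_nonpos.2 (mem_Ici.1 hx), neg_neg x⟩⟩
    simp only [neg_one_mul]
    exact hneg.comp h₂.bijOn
  eq_left z hz := by
    rw [coord_zero]
    simp only [one_mul, add_zero, wave, glue_of_nonpos (h₁.neg z hz).le, h₁.comp z hz.le]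
  eq_right z hz := by
    rw [coord_zero]
    simp only [neg_one_mul, add_zero, wave, glue_of_pos (neg_pos.2 (h₂.neg z hz)), neg_neg,
      h₂.comp z hz.le, sub_eq_add_neg]

end FornbergWhitham

open FornbergWhitham in
theorem mainTheorem1 (A B c : ℝ) (hc : c = 1 + (A + B) / 2) (hBc : B + 2 < c) (hcA : c < A) :
    IsSaddle (field c ((A - c) ^ 2 / 2 + A)) (A, 0) ∧
    IsSaddle (field c ((A - c) ^ 2 / 2 + A)) (B, 0) ∧
    ∃ W : ℝ → ℝ,
      IsPiecewiseC2 W ∧ HasJump W ∧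
      Tendsto W atBot (𝓝 A) ∧ Tendsto W atTop (𝓝 B) ∧
      IsWeakSolution (fun x t => W (x - c * t)) W ∧
      ∃ (P Q : ℝ → ℝ × ℝ) (b₁ b₂ : ℝ),
        IsPatched A B c ((A - c) ^ 2 / 2 + A) W P Q b₁ b₂ := by
  obtain ⟨a, rfl⟩ : ∃ a, A = c + a := ⟨A - c, by ring⟩
  obtain rfl : B = c - (a + 2) := by linarith
  have ha : 0 < a := by linarith
  rw [add_sub_cancel_left]
  obtain ⟨v₁, V₁, o₁⟩ := exists_isHalfOrbit (ρ := a) (κ := 1) (by norm_num) ha (by linarith)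
  obtain ⟨v₂, V₂, o₂⟩ := exists_isHalfOrbit (ρ := a + 2) (κ := -1) (by norm_num) (by linarith)
    (by linarith)
  obtain ⟨Y₁, Z₁, h₁⟩ := o₁.exists_isHalfProfile (by norm_num) ha (by linarith)
  obtain ⟨Y₂, Z₂, h₂⟩ := o₂.exists_isHalfProfile (by norm_num) (by linarith) (by linarith)
  exact ⟨isSaddle_of_pos (by ring) (by nlinarith), isSaddle_of_pos (by ring) (by nlinarith),
    wave c Y₁ Y₂, isPiecewiseC2_wave ha h₁ h₂, hasJump_wave ha h₁ h₂,
    tendsto_glue_atBot (h₁.tendsto_fst.const_add c),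
    tendsto_glue_atTop (h₂.tendsto_fst.const_sub c), isWeakSolution_wave ha h₁ h₂,
    _, _, 0, 0, isPatched_wave ha h₁ h₂ o₁ o₂⟩
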